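/- Let $R$ be a commutative noetherian local ring of depth $d$, and assume that $d>0$ or that $\dim R=0$. Suppose that: - $R$ is generically Gorenstein, i.e. $R_{\mathfrak p}$ is Gorenstein (has finite injective dimension over itself) for every minimal prime $\mathfrak p$ of $R$; - $R$ satisfies Serre's condition $(S_d)$, i.e. $\operatorname{depth} R_{\mathfrak p}\ge\min\{d,\dim R_{\mathfrak p}\}$ for every prime ideal $\mathfrak p$ of $R$; - $R$ satisfies $(ES_1^R)$, i.e. every finitely generated $R$-module $X$ with $\operatorname{Ext}^i_R(X,R)=0$ for all $i>0$ satisfies $\operatorname{depth} X_{\mathfrak p}\ge\min\{1,\operatorname{depth} R_{\mathfrak p}\}$ for every prime ideal $\mathfrak p$ of $R$ (the zero module has depth $\infty$). Let $M$ be a finitely generated $R$-module with $\operatorname{Ext}^i_R(M,R)=0$ for all $i>0$. Then $M$ is totally reflexive: writing $M^*=\operatorname{Hom}_R(M,R)$, the natural map $M\to M^{**}$ is an isomorphism and $\operatorname{Ext}^i_R(M,R)=0=\operatorname{Ext}^i_R(M^*,R)$ for all $i>0$. -/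

import Mathlib

universe u

open CategoryTheory

/-- The depth of a finitely generated module `M` over a noetherian local ring `R`: the supremum of
the lengths of the `M`-regular sequences in the maximal ideal. For `M ≠ 0` weakly regular sequences
in the maximal ideal are regular (Nakayama); the zero module has depth `∞`, as usual. -/
noncomputable def moduleDepth (R : Type u) [CommRing R] [IsLocalRing R]
    (M : Type u) [AddCommGroup M] [Module R M] : ℕ∞ :=
  ⨆ (rs : List R) (_ : ∀ r ∈ rs, r ∈ IsLocalRing.maximalIdeal R)
    (_ : RingTheory.Sequence.IsWeaklyRegular M rs), (rs.length : ℕ∞)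

/-- The depth of the localization `M_p` as a module over the local ring `R_p`. -/
noncomputable def depthAt (R : Type u) [CommRing R] (p : Ideal R) [p.IsPrime]
    (M : Type u) [AddCommGroup M] [Module R M] : ℕ∞ :=
  moduleDepth (Localization.AtPrime p) (LocalizedModule.AtPrime p M)

/-- Serre's condition `(S_n)`: `depth M_p ≥ min {n, dim R_p}` for all primes `p` of `R`. -/
def SatisfiesSerre (R : Type u) [CommRing R] (n : ℕ)
    (M : Type u) [AddCommGroup M] [Module R M] : Prop :=
  ∀ (p : Ideal R) [p.IsPrime],
    min ((n : ℕ∞) : WithBot ℕ∞) (ringKrullDim (Localization.AtPrime p)) ≤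
      (depthAt R p M : WithBot ℕ∞)

/-- The condition `(S̃_n)`: `depth M_p ≥ min {n, depth R_p}` for all primes `p` of `R`. -/
def SatisfiesSerreTilde (R : Type u) [CommRing R] (n : ℕ)
    (M : Type u) [AddCommGroup M] [Module R M] : Prop :=
  ∀ (p : Ideal R) [p.IsPrime],
    min (n : ℕ∞) (moduleDepth (Localization.AtPrime p) (Localization.AtPrime p)) ≤ depthAt R p M

/-- `Ext^i_R(M, N) = 0` for all `i > 0`. -/
def ExtPosVanishes (R : Type u) [CommRing R] (M N : Type u) [AddCommGroup M] [Module R M]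
    [AddCommGroup N] [Module R N] : Prop :=
  ∀ i : ℕ, 0 < i → Subsingleton (Abelian.Ext (ModuleCat.of R M) (ModuleCat.of R N) i)

/-- The condition `(ES_n^C)`: every finitely generated `R`-module `X` with `Ext^{>0}_R(X, C) = 0`
satisfies `(S̃_n)`. -/
def SatisfiesES (R : Type u) [CommRing R] (C : Type u) [AddCommGroup C] [Module R C]
    (n : ℕ) : Prop :=
  ∀ (X : Type u) [AddCommGroup X] [Module R X] [Module.Finite R X],
    ExtPosVanishes R X C → SatisfiesSerreTilde R n X

/-- A noetherian local ring is Gorenstein if it has finite injective dimension over itself. -/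
def IsGorensteinLocal (R : Type u) [CommRing R] [IsLocalRing R] : Prop :=
  IsNoetherianRing R ∧ injectiveDimension (ModuleCat.of R R) ≠ ⊤

/-- `R` is generically Gorenstein if `R_p` is Gorenstein for every minimal prime `p` of `R`. -/
def IsGenericallyGorenstein (R : Type u) [CommRing R] : Prop :=
  ∀ (p : Ideal R) [p.IsPrime], p ∈ minimalPrimes R → IsGorensteinLocal (Localization.AtPrime p)

/-- A (finitely generated) module `M` is totally reflexive if the natural map `M → M^{**}` is an
isomorphism and `Ext^{>0}_R(M, R) = 0 = Ext^{>0}_R(M^*, R)`. -/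
def IsTotallyReflexive (R : Type u) [CommRing R] (M : Type u) [AddCommGroup M]
    [Module R M] : Prop :=
  Function.Bijective (Module.Dual.eval R M) ∧
    ExtPosVanishes R M R ∧ ExtPosVanishes R (Module.Dual R M) R

/-! Consider the class of finitely generated X with Ext^{>0}(X, R) = 0. It suffices that all its
members are torsionless. Generators of X* then embed X in some R^n so that every functional on X
extends; hence the cokernel Y has Ext^1(Y, R) = 0 and is again in the class. Since Y is torsionless,
X is reflexive, and the exact sequence 0 → Y* → (R^n)* → X* → 0 moves Ext^{k+1}(X*, R) to Ext^k(Y*,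
R), which allows induction on k.

For torsionlessness, a nonzero x has a multiple y whose annihilator is a prime p, so depth X_p = 0.
If d > 0, (ES_1) gives depth R_p = 0 and (S_d) gives dim R_p = 0; otherwise dim R = 0 suffices. So
R_p is artinian Gorenstein, hence self-injective and a cogenerator: some map X_p → R_p is nonzero at
y, and clearing denominators yields a functional on X. -/

section ExtSequences

variable {R : Type u} [CommRing R] {X Y Z N : Type u} [AddCommGroup X] [Module R X]
  [AddCommGroup Y] [Module R Y] [AddCommGroup Z] [Module R Z] [AddCommGroup N] [Module R N]
  {f : X →ₗ[R] Y} {g : Y →ₗ[R] Z}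

theorem shortExact_of_exact (hf : Function.Injective f) (hg : Function.Surjective g)
    (h : Function.Exact f g) :
    (ModuleCat.shortComplexOfCompEqZero f g h.linearMap_comp_eq_zero).ShortExact :=
  ModuleCat.shortComplex_shortExact _ h hf hg

/-- In a short exact sequence `0 → X → Y → Z → 0` with `Ext¹(Z, N) = 0`, every map `X → N`
extends to `Y`. -/
theorem exists_extension_of_subsingleton_ext_one (hf : Function.Injective f)
    (hg : Function.Surjective g) (h : Function.Exact f g)
    (hZ : Subsingleton (Abelian.Ext (ModuleCat.of R Z) (ModuleCat.of R N) 1)) (φ : X →ₗ[R] N) :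
    ∃ ψ : Y →ₗ[R] N, ψ ∘ₗ f = φ := by
  have hS := shortExact_of_exact hf hg h
  obtain ⟨x₂, hx₂⟩ := Abelian.Ext.contravariant_sequence_exact₁ hS (ModuleCat.of R N)
    (Abelian.Ext.mk₀ (ModuleCat.ofHom φ)) (n₁ := 1) rfl (hZ.elim _ _)
  obtain ⟨ψ, rfl⟩ := (Abelian.Ext.mk₀_bijective _ _).2 x₂
  rw [Abelian.Ext.mk₀_comp_mk₀] at hx₂
  have := (Abelian.Ext.mk₀_bijective _ _).1 hx₂
  exact ⟨ψ.hom, by simpa using congrArg ModuleCat.Hom.hom this⟩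

/-- Dimension shifting from the left end of a short exact sequence. -/
theorem subsingleton_ext_left (hf : Function.Injective f) (hg : Function.Surjective g)
    (h : Function.Exact f g) {n : ℕ}
    (hY : Subsingleton (Abelian.Ext (ModuleCat.of R Y) (ModuleCat.of R N) n))
    (hZ : Subsingleton (Abelian.Ext (ModuleCat.of R Z) (ModuleCat.of R N) (n + 1))) :
    Subsingleton (Abelian.Ext (ModuleCat.of R X) (ModuleCat.of R N) n) := by
  have hS := shortExact_of_exact hf hg h
  refine subsingleton_of_forall_eq 0 fun x ↦ ?_
  obtain ⟨x₂, rfl⟩ := Abelian.Ext.contravariant_sequence_exact₁ hS (ModuleCat.of R N)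
    x (n₁ := n + 1) (add_comm _ _) (hZ.elim _ _)
  rw [show x₂ = 0 from hY.elim _ _, Abelian.Ext.comp_zero]

theorem subsingleton_ext_middle (hf : Function.Injective f) (hg : Function.Surjective g)
    (h : Function.Exact f g) {n : ℕ}
    (hX : Subsingleton (Abelian.Ext (ModuleCat.of R X) (ModuleCat.of R N) n))
    (hZ : Subsingleton (Abelian.Ext (ModuleCat.of R Z) (ModuleCat.of R N) n)) :
    Subsingleton (Abelian.Ext (ModuleCat.of R Y) (ModuleCat.of R N) n) := by
  have hS := shortExact_of_exact hf hg h
  refine subsingleton_of_forall_eq 0 fun x ↦ ?_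
  obtain ⟨x₂, rfl⟩ := Abelian.Ext.contravariant_sequence_exact₂ hS (ModuleCat.of R N)
    x (hX.elim _ _)
  rw [show x₂ = 0 from hZ.elim _ _, Abelian.Ext.comp_zero]

theorem subsingleton_ext_right [Module.Projective R Y] (hf : Function.Injective f)
    (hg : Function.Surjective g) (h : Function.Exact f g) {n : ℕ}
    (hX : Subsingleton (Abelian.Ext (ModuleCat.of R X) (ModuleCat.of R N) n)) :
    Subsingleton (Abelian.Ext (ModuleCat.of R Z) (ModuleCat.of R N) (n + 1)) := by
  have hS := shortExact_of_exact hf hg h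
  refine subsingleton_of_forall_eq 0 fun x ↦ ?_
  obtain ⟨x₁, rfl⟩ := Abelian.Ext.contravariant_sequence_exact₃ hS (ModuleCat.of R N)
    x (Abelian.Ext.eq_zero_of_projective (P := ModuleCat.of R Y) _) (add_comm 1 n)
  rw [show x₁ = 0 from hX.elim _ _, Abelian.Ext.comp_zero]

/-- If every map `X → N` extends along `X → Y` with `Y` projective, then `Ext¹(Y / X, N) = 0`. -/
theorem subsingleton_ext_one_right [Module.Projective R Y] (hf : Function.Injective f)
    (hg : Function.Surjective g) (h : Function.Exact f g)
    (hext : ∀ φ : X →ₗ[R] N, ∃ ψ : Y →ₗ[R] N, ψ ∘ₗ f = φ) :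
    Subsingleton (Abelian.Ext (ModuleCat.of R Z) (ModuleCat.of R N) 1) := by
  have hS := shortExact_of_exact hf hg h
  refine subsingleton_of_forall_eq 0 fun x ↦ ?_
  obtain ⟨x₁, rfl⟩ := Abelian.Ext.contravariant_sequence_exact₃ hS (ModuleCat.of R N)
    x (Abelian.Ext.eq_zero_of_projective (P := ModuleCat.of R Y) _) (n₀ := 0) rfl
  obtain ⟨φ, rfl⟩ := (Abelian.Ext.mk₀_bijective _ _).2 x₁
  obtain ⟨ψ, hψ⟩ := hext φ.hom
  have : φ = ModuleCat.ofHom f ≫ ModuleCat.ofHom ψ := by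
    ext1
    simpa using hψ.symm
  rw [this, ← Abelian.Ext.mk₀_comp_mk₀]
  exact hS.extClass_comp_assoc _

end ExtSequences

/-! ### From torsionless to totally reflexive -/

section TotallyReflexive

variable {R : Type u} [CommRing R]

/-- A torsionless module embeds in a finite free module such that all functionals extend. -/
theorem exists_embedding_of_dual_eval_injective {X : Type u} [AddCommGroup X] [Module R X]
    [Module.Finite R (Module.Dual R X)] (hX : Function.Injective (Module.Dual.eval R X)) :
    ∃ (n : ℕ) (i : X →ₗ[R] (Fin n → R)), Function.Injective i ∧
      ∀ φ : X →ₗ[R] R, ∃ ψ : (Fin n → R) →ₗ[R] R, ψ ∘ₗ i = φ := by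
  obtain ⟨n, π, hπ⟩ := Module.Finite.exists_fin' R (Module.Dual R X)
  have key : ∀ c x, π c x = ∑ k, c k * π (Pi.single k 1) x := by
    intro c x
    have hs : ∀ k, (Pi.single k 1 : Fin n → R) = fun j ↦ if k = j then 1 else 0 := fun k ↦ by
      ext j
      simp [Pi.single_apply, eq_comm]
    rw [LinearMap.pi_apply_eq_sum_univ π c]
    simp only [LinearMap.sum_apply, LinearMap.smul_apply, smul_eq_mul, hs]
  -- The coordinates are generators of the dual, so every functional on X is a linear form in them.
  let i : X →ₗ[R] (Fin n → R) := LinearMap.pi fun k ↦ π (Pi.single k 1)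
  refine ⟨n, i, ?_, ?_⟩
  · rw [injective_iff_map_eq_zero]
    intro x hx
    rw [← map_eq_zero_iff _ hX]
    ext φ
    obtain ⟨c, rfl⟩ := hπ φ
    have : ∀ k, π (Pi.single k 1) x = 0 := fun k ↦ congrFun hx k
    rw [Module.Dual.eval_apply, key]
    simp [this]
  · intro φ
    obtain ⟨c, rfl⟩ := hπ φ
    refine ⟨∑ k, c k • LinearMap.proj k, ?_⟩
    ext x
    rw [key]
    simp [i]

variable {X F Y : Type u} [AddCommGroup X] [Module R X]
  [AddCommGroup F] [Module R F] [AddCommGroup Y] [Module R Y] {i : X →ₗ[R] F} {p : F →ₗ[R] Y}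

/-- Pushed to F**, an element of X** is evaluation at some v. All functionals on Y kill `p v`, so v
comes from X. -/
theorem dual_eval_surjective_of_exact [Module.IsReflexive R F] (h : Function.Exact i p)
    (hext : ∀ φ : X →ₗ[R] R, ∃ ψ : F →ₗ[R] R, ψ ∘ₗ i = φ)
    (hY : Function.Injective (Module.Dual.eval R Y)) :
    Function.Surjective (Module.Dual.eval R X) := by
  intro α
  obtain ⟨v, hv⟩ := (Module.bijective_dual_eval R F).2 (α ∘ₗ i.dualMap)
  have hv' : ∀ ψ : F →ₗ[R] R, ψ v = α (ψ ∘ₗ i) := fun ψ ↦ LinearMap.congr_fun hv ψ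
  have hpv : p v = 0 := by
    rw [← map_eq_zero_iff _ hY]
    ext φ
    have : (φ ∘ₗ p) ∘ₗ i = 0 := by rw [LinearMap.comp_assoc, h.linearMap_comp_eq_zero]; simp
    simpa [this] using hv' (φ ∘ₗ p)
  obtain ⟨x, rfl⟩ := (h v).1 hpv
  refine ⟨x, ?_⟩
  ext φ
  obtain ⟨ψ, rfl⟩ := hext φ
  simpa using hv' ψ

theorem exact_dualMap (hp : Function.Surjective p) (h : Function.Exact i p) :
    Function.Exact p.dualMap i.dualMap := by
  intro ψ
  constructor
  · intro hψ
    have hk : LinearMap.ker p ≤ LinearMap.ker ψ := by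
      intro v hv
      obtain ⟨x, rfl⟩ := (h v).1 hv
      exact LinearMap.congr_fun hψ x
    refine ⟨(LinearMap.ker p).liftQ ψ hk ∘ₗ (p.quotKerEquivOfSurjective hp).symm.toLinearMap, ?_⟩
    ext v
    have : (p.quotKerEquivOfSurjective hp).symm (p v) = Submodule.Quotient.mk v := by
      rw [LinearEquiv.symm_apply_eq]
      rfl
    simp [this]
  · rintro ⟨φ, rfl⟩
    ext x
    simp [h.apply_apply_eq_zero]

/-- If every finitely generated module `X` with `Ext^{>0}(X, R) = 0` is torsionless, then every
such module is totally reflexive. -/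
theorem isTotallyReflexive_of_forall_dual_eval_injective [IsNoetherianRing R]
    (H : ∀ (X : Type u) [AddCommGroup X] [Module R X] [Module.Finite R X],
      ExtPosVanishes R X R → Function.Injective (Module.Dual.eval R X))
    (M : Type u) [AddCommGroup M] [Module R M] [Module.Finite R M]
    (hM : ExtPosVanishes R M R) : IsTotallyReflexive R M := by
  have coker : ∀ (X : Type u) [AddCommGroup X] [Module R X] [Module.Finite R X],
      ExtPosVanishes R X R → ∃ (n : ℕ) (i : X →ₗ[R] (Fin n → R)), Function.Injective i ∧
      (∀ φ : X →ₗ[R] R, ∃ ψ : (Fin n → R) →ₗ[R] R, ψ ∘ₗ i = φ) ∧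
      ExtPosVanishes R ((Fin n → R) ⧸ LinearMap.range i) R := by
    intro X _ _ _ hX
    obtain ⟨n, i, hi, hext⟩ := exists_embedding_of_dual_eval_injective (H X hX)
    refine ⟨n, i, hi, hext, fun k hk ↦ ?_⟩
    obtain _ | _ | k := k
    · exact absurd hk (lt_irrefl 0)
    · exact subsingleton_ext_one_right hi (Submodule.mkQ_surjective _)
        i.exact_map_mkQ_range hext
    · exact subsingleton_ext_right hi (Submodule.mkQ_surjective _)
        i.exact_map_mkQ_range (hX (k + 1) k.succ_pos)
  have refl : ∀ (X : Type u) [AddCommGroup X] [Module R X] [Module.Finite R X],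
      ExtPosVanishes R X R → Function.Bijective (Module.Dual.eval R X) := by
    intro X _ _ _ hX
    obtain ⟨n, i, hi, hext, hY⟩ := coker X hX
    exact ⟨H X hX, dual_eval_surjective_of_exact i.exact_map_mkQ_range hext (H _ hY)⟩
  have ext : ∀ (k : ℕ) (X : Type u) [AddCommGroup X] [Module R X] [Module.Finite R X],
      ExtPosVanishes R X R →
      Subsingleton (Abelian.Ext (ModuleCat.of R (Module.Dual R X)) (ModuleCat.of R R) (k + 1)) := by
    intro k
    induction k with
    | zero =>
      intro X _ _ _ hX
      obtain ⟨n, i, hi, hext, hY⟩ := coker X hX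
      have hp := Submodule.mkQ_surjective (LinearMap.range i)
      refine subsingleton_ext_one_right (LinearMap.dualMap_injective_of_surjective hp)
        (fun φ ↦ hext φ) (exact_dualMap hp i.exact_map_mkQ_range) fun β ↦ ?_
      -- By reflexivity of the cokernel, β is evaluation at some y; evaluation at a lift of y
      -- extends it.
      obtain ⟨y, rfl⟩ := (refl _ hY).2 β
      obtain ⟨v, rfl⟩ := hp y
      exact ⟨Module.Dual.eval R _ v, rfl⟩
    | succ k ih =>
      intro X _ _ _ hX
      obtain ⟨n, i, hi, hext, hY⟩ := coker X hX
      have hp := Submodule.mkQ_surjective (LinearMap.range i)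
      exact subsingleton_ext_right (LinearMap.dualMap_injective_of_surjective hp)
        (fun φ ↦ hext φ) (exact_dualMap hp i.exact_map_mkQ_range) (ih _ hY)
  refine ⟨refl M hM, hM, fun k hk ↦ ?_⟩
  obtain ⟨k, rfl⟩ := Nat.exists_eq_succ_of_ne_zero hk.ne'
  exact ext k M hM

end TotallyReflexive

/-! ### Self-injectivity over artinian local rings -/

section ArtinianLocal

variable {A : Type u} [CommRing A] [IsLocalRing A] [IsNoetherianRing A] [Ring.KrullDimLE 0 A]

theorem exists_injective_residue (A : Type u) [CommRing A] [IsLocalRing A] [IsNoetherianRing A]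
    [Ring.KrullDimLE 0 A] :
    ∃ f : A ⧸ IsLocalRing.maximalIdeal A →ₗ[A] A, Function.Injective f := by
  obtain ⟨P, hP, -⟩ := exists_le_isAssociatedPrime_of_isNoetherianRing A (1 : A) one_ne_zero
  have hP' := (isAssociatedPrime_iff_exists_injective_linearMap _ _).1 hP
  have := hP'.1
  obtain rfl := Ring.KrullDimLE.eq_maximalIdeal_of_isPrime P
  exact hP'.2

/-- Descending step in the degree: a prime filtration reduces to the residue field, which embeds in
A with finitely generated cokernel. -/
theorem subsingleton_ext_of_succ {N : Type u} [AddCommGroup N] [Module A N] {n : ℕ}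
    (hA : Subsingleton (Abelian.Ext (ModuleCat.of A A) (ModuleCat.of A N) n))
    (h : ∀ (X : Type u) [AddCommGroup X] [Module A X] [Module.Finite A X],
      Subsingleton (Abelian.Ext (ModuleCat.of A X) (ModuleCat.of A N) (n + 1)))
    (X : Type u) [AddCommGroup X] [Module A X] [Module.Finite A X] :
    Subsingleton (Abelian.Ext (ModuleCat.of A X) (ModuleCat.of A N) n) := by
  induction ‹Module.Finite A X› using
    IsNoetherianRing.induction_on_isQuotientEquivQuotientPrime A with
  | subsingleton X =>
    have : Limits.IsZero (ModuleCat.of A X) := ModuleCat.isZero_of_subsingleton _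
    refine subsingleton_of_forall_eq 0 fun x ↦ ?_
    rw [← Abelian.Ext.mk₀_id_comp x, (Limits.IsZero.iff_id_eq_zero _).1 this]
    simp
  | quotient X p e =>
    obtain ⟨f, hf⟩ := exists_injective_residue A
    have hp := Ring.KrullDimLE.eq_maximalIdeal_of_isPrime p.1
    let f' : X →ₗ[A] A := f ∘ₗ (e.trans (Submodule.quotEquivOfEq _ _ hp)).toLinearMap
    have hf' : Function.Injective f' := hf.comp (LinearEquiv.injective _)
    exact subsingleton_ext_left hf' (Submodule.mkQ_surjective _) f'.exact_map_mkQ_range hA (h _)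
  | exact X₁ X₂ X₃ f g hf hg hfg h₁ h₃ => exact subsingleton_ext_middle hf hg hfg h₁ h₃

/-- Over an artinian local ring, modules of finite injective dimension are injective. -/
theorem injective_of_injectiveDimension_ne_top (N : Type u) [AddCommGroup N] [Module A N]
    (hN : injectiveDimension (ModuleCat.of A N) ≠ ⊤) : Module.Injective A N := by
  obtain ⟨n, hn⟩ := (injectiveDimension_ne_top_iff _).1 hN
  have key : ∀ (X : Type u) [AddCommGroup X] [Module A X] [Module.Finite A X],
      Subsingleton (Abelian.Ext (ModuleCat.of A X) (ModuleCat.of A N) 1) := by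
    have hn' : ∀ (X : Type u) [AddCommGroup X] [Module A X] [Module.Finite A X],
        Subsingleton (Abelian.Ext (ModuleCat.of A X) (ModuleCat.of A N) (n + 1)) :=
      fun X _ _ _ ↦ HasInjectiveDimensionLT.subsingleton _ (n + 1) _ le_rfl _
    clear hn
    induction n with
    | zero => exact hn'
    | succ n ih =>
      exact ih (subsingleton_ext_of_succ
        (Abelian.Ext.subsingleton_of_projective (ModuleCat.of A A) _ n) hn')
  refine Module.Baer.injective fun I φ ↦ ?_
  obtain ⟨ψ, hψ⟩ := exists_extension_of_subsingleton_ext_one I.injective_subtype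
    (Submodule.mkQ_surjective I) (LinearMap.exact_subtype_mkQ I) (key _) φ
  exact ⟨ψ, fun x hx ↦ LinearMap.congr_fun hψ ⟨x, hx⟩⟩

/-- A self-injective artinian local ring is a cogenerator. -/
theorem exists_linearMap_apply_ne_zero (hA : Module.Injective A A) {N : Type u} [AddCommGroup N]
    [Module A N] {y : N} (hy : y ≠ 0) : ∃ g : N →ₗ[A] A, g y ≠ 0 := by
  obtain ⟨f, hf⟩ := exists_injective_residue A
  let t := LinearMap.toSpanSingleton A N y
  have hker : LinearMap.ker t ≤ IsLocalRing.maximalIdeal A := by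
    refine IsLocalRing.le_maximalIdeal fun h ↦ hy ?_
    have : (1 : A) ∈ LinearMap.ker t := h ▸ Submodule.mem_top
    simpa [t] using this
  -- The map Ay ≅ A/ann(y) → residue field → A extends to N by injectivity, and it is nonzero at y.
  obtain ⟨g, hg⟩ := hA.out ((LinearMap.ker t).liftQ t le_rfl)
    (LinearMap.ker_eq_bot.1 (Submodule.ker_liftQ_eq_bot' _ _ rfl))
    (f ∘ₗ Submodule.factor hker)
  refine ⟨g, fun h ↦ one_ne_zero (α := A ⧸ IsLocalRing.maximalIdeal A) (hf ?_)⟩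
  have := hg (Submodule.Quotient.mk 1)
  simp only [Submodule.liftQ_apply, t, LinearMap.toSpanSingleton_apply, one_smul, h] at this
  rw [map_zero, this]
  rfl

end ArtinianLocal

/-! ### Depth zero at associated primes -/

section Depth

theorem moduleDepth_congr {A : Type u} [CommRing A] [IsLocalRing A] {M N : Type u}
    [AddCommGroup M] [Module A M] [AddCommGroup N] [Module A N] (e : M ≃ₗ[A] N) :
    moduleDepth A M = moduleDepth A N := by
  simp only [moduleDepth, e.isWeaklyRegular_congr]

theorem moduleDepth_eq_zero_of_maximalIdeal_smul_eq_zero {A : Type u} [CommRing A] [IsLocalRing A]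
    {M : Type u} [AddCommGroup M] [Module A M] {y : M} (hy : y ≠ 0)
    (h : ∀ a ∈ IsLocalRing.maximalIdeal A, a • y = 0) : moduleDepth A M = 0 := by
  refine le_antisymm (iSup_le fun rs ↦ iSup_le fun hrs ↦ iSup_le fun hreg ↦ ?_) bot_le
  cases rs with
  | nil => simp
  | cons r rs =>
    have hr := ((RingTheory.Sequence.isWeaklyRegular_cons_iff M r rs).1 hreg).1
    refine absurd (hr ?_) hy
    simpa using h r (hrs r List.mem_cons_self)

variable {R : Type u} [CommRing R] (p : Ideal R) [p.IsPrime]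

theorem depthAt_self :
    depthAt R p R = moduleDepth (Localization.AtPrime p) (Localization.AtPrime p) :=
  moduleDepth_congr ((IsLocalizedModule.linearEquiv p.primeCompl
    (LocalizedModule.mkLinearMap p.primeCompl R)
    (Algebra.linearMap R (Localization.AtPrime p))).extendScalarsOfIsLocalization p.primeCompl
      (Localization.AtPrime p))

variable {X : Type u} [AddCommGroup X] [Module R X] {p} {y : X}

theorem mkLinearMap_ne_zero_of_colon_le (hy : (⊥ : Submodule R X).colon {y} ≤ p) :
    LocalizedModule.mkLinearMap p.primeCompl X y ≠ 0 := by
  intro h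
  obtain ⟨s, hs⟩ := (IsLocalizedModule.eq_zero_iff p.primeCompl _).1 h
  exact s.2 (hy (by simpa [Submodule.mem_colon_singleton, Submonoid.smul_def] using hs))

theorem depthAt_eq_zero_of_eq_colon (hy : p = (⊥ : Submodule R X).colon {y}) :
    depthAt R p X = 0 := by
  refine moduleDepth_eq_zero_of_maximalIdeal_smul_eq_zero
    (mkLinearMap_ne_zero_of_colon_le hy.ge) fun a ha ↦ ?_
  obtain ⟨r, s, rfl⟩ := IsLocalization.exists_mk'_eq p.primeCompl a
  have hr : r • y = 0 := by
    have : r ∈ p := by simpa using (IsLocalization.AtPrime.mk'_mem_maximal_iff _ p r s).1 ha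
    rw [hy] at this
    simpa [Submodule.mem_colon_singleton] using this
  rw [LocalizedModule.mkLinearMap_apply, ← Localization.mk_eq_mk', LocalizedModule.mk_smul_mk, hr]
  simp

end Depth

/-! ### Detecting elements by functionals -/

section Torsionless

variable {R : Type u} [CommRing R] [IsNoetherianRing R]

/-- Finite presentation lifts a localized functional to X up to a factor s outside p, which acts
injectively on R_p. -/
theorem exists_dual_apply_ne_zero_of_localization {p : Ideal R} [p.IsPrime]
    [Ring.KrullDimLE 0 (Localization.AtPrime p)]
    (hp : IsGorensteinLocal (Localization.AtPrime p)) {X : Type u} [AddCommGroup X] [Module R X]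
    [Module.Finite R X] {y : X} (hy : LocalizedModule.mkLinearMap p.primeCompl X y ≠ 0) :
    ∃ φ : X →ₗ[R] R, φ y ≠ 0 := by
  have := hp.1
  obtain ⟨g, hg⟩ := exists_linearMap_apply_ne_zero
    (injective_of_injectiveDimension_ne_top (A := Localization.AtPrime p) _ hp.2) hy
  have := Module.finitePresentation_of_finite R X
  obtain ⟨φ, s, hφ⟩ := Module.FinitePresentation.exists_lift_of_isLocalizedModule
    p.primeCompl (Algebra.linearMap R (Localization.AtPrime p))
    (g.restrictScalars R ∘ₗ LocalizedModule.mkLinearMap p.primeCompl X)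
  refine ⟨φ, fun h ↦ hg ?_⟩
  have := LinearMap.congr_fun hφ y
  simp only [LinearMap.comp_apply, h, map_zero, LinearMap.smul_apply] at this
  refine IsLocalizedModule.smul_injective (Algebra.linearMap R (Localization.AtPrime p)) s ?_
  simpa using this.symm

theorem dual_eval_injective_of_forall_associatedPrimes {X : Type u} [AddCommGroup X] [Module R X]
    [Module.Finite R X]
    (H : ∀ (p : Ideal R) [p.IsPrime], depthAt R p X = 0 →
      ringKrullDim (Localization.AtPrime p) ≤ 0 ∧ IsGorensteinLocal (Localization.AtPrime p)) :
    Function.Injective (Module.Dual.eval R X) := by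
  rw [injective_iff_map_eq_zero]
  intro x hx
  by_contra hx0
  -- Working inside Rx makes the witness a multiple of x, so a functional nonzero on it is nonzero
  -- at x.
  obtain ⟨p, hp, hpx⟩ := exists_le_isAssociatedPrime_of_isNoetherianRing R
    (⟨x, Submodule.mem_span_singleton_self x⟩ : Submodule.span R {x}) (by simpa using hx0)
  obtain ⟨hprime, ⟨z, hz⟩, hpz⟩ := isAssociatedPrime_iff.1 hp
  obtain ⟨r, rfl⟩ := Submodule.mem_span_singleton.1 hz
  have hpy : p = (⊥ : Submodule R X).colon {r • x} := by
    rw [hpz]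
    ext a
    simp [Submodule.mem_colon_singleton]
  obtain ⟨hdim, hG⟩ := H p (depthAt_eq_zero_of_eq_colon hpy)
  have : Ring.KrullDimLE 0 (Localization.AtPrime p) := Ring.krullDimLE_iff.2 hdim
  obtain ⟨φ, hφ⟩ := exists_dual_apply_ne_zero_of_localization hG
    (mkLinearMap_ne_zero_of_colon_le hpy.ge)
  refine hφ ?_
  have : φ x = 0 := LinearMap.congr_fun hx φ
  simp [this]

end Torsionless

theorem corollary4p4 (R : Type u) [CommRing R] [IsLocalRing R] [IsNoetherianRing R]
    (d : ℕ) (hdepth : moduleDepth R R = (d : ℕ∞))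
    (hd : 0 < d ∨ ringKrullDim R = 0)
    (hG : IsGenericallyGorenstein R)
    (hS : SatisfiesSerre R d R)
    (hES : SatisfiesES R R 1)
    (M : Type u) [AddCommGroup M] [Module R M] [Module.Finite R M]
    (hM : ExtPosVanishes R M R) :
    IsTotallyReflexive R M := by
  refine isTotallyReflexive_of_forall_dual_eval_injective (fun X _ _ _ hX ↦ ?_) M hM
  refine dual_eval_injective_of_forall_associatedPrimes fun p _ hp ↦ ?_
  have hdim : ringKrullDim (Localization.AtPrime p) ≤ 0 := by
    obtain hd | hd := hd
    · have hR : depthAt R p R = 0 := by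
        have := hES X hX p
        rw [hp, ← depthAt_self] at this
        simpa using this
      have := hS p
      rw [hR] at this
      -- As d > 0, the minimum can vanish only through the dimension.
      refine (min_le_iff.1 this).resolve_left fun h ↦ ?_
      have : (d : ℕ∞) ≤ 0 := by exact_mod_cast h
      simp at this
      omega
    · rw [IsLocalization.AtPrime.ringKrullDim_eq_height p, ← hd]
      exact Ideal.height_le_ringKrullDim_of_isPrime
  refine ⟨hdim, hG p ?_⟩
  rw [IsLocalization.AtPrime.ringKrullDim_eq_height p] at hdim
  rw [← Ideal.height_eq_zero_iff]
  exact nonpos_iff_eq_zero.1 (by exact_mod_cast hdim)
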